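/- Let $\mathbb K$ be an arbitrary field and let $A=\mathbb K[X_1][X_2;\sigma_2,\delta_2]\cdots[X_N;\sigma_N,\delta_N]$ be an iterated Ore extension, where, with $A_{i}:=\mathbb K\langle X_1,\dots,X_i\rangle$ (so $A_0=\mathbb K$, $A_N=A$), each $\sigma_i$ is a $\mathbb K$-algebra automorphism of $A_{i-1}$ and each $\delta_i$ is a $\mathbb K$-linear map of $A_{i-1}$ with $\delta_i(ab)=\sigma_i(a)\delta_i(b)+\delta_i(a)b$; that is, $A_i$ is a free left $A_{i-1}$-module with basis $1,X_i,X_i^2,\dots$ and $X_ir=\sigma_i(r)X_i+\delta_i(r)$ for $r\in A_{i-1}$. Assume: 1. $\sigma_i(X_l)=\lambda_{i,l}X_l$ for all $1\le l<i\le N$, where $\Lambda=(\lambda_{i,j})\in M_N(\mathbb K^*)$ satisfies $\lambda_{i,l}=\lambda_{l,i}^{-1}$ for all $i,l$. 2. For $2\le i\le N$ there is given $q_i\in\mathbb K^*$, $q_i\neq1$, with $\delta_i\circ\sigma_i=q_i\,\sigma_i\circ\delta_i$. 3. For $2\le i\le N$ there is given a sequence $(d_{i,n})_{n\ge0}$ of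 $\mathbb K$-linear operators on $A_{i-1}$ such that $d_{i,0}=\mathrm{id}$, $d_{i,1}=\delta_i$, $d_{i,n}(rs)=\sum_{k=0}^n\sigma_i^{n-k}(d_{i,k}(r))\,d_{i,n-k}(s)$, $d_{i,n}\circ\sigma_i=q_i^n\,\sigma_i\circ d_{i,n}$, and $d_{i,n}\circ d_{i,m}=\binom{n+m}{m}_{q_i}d_{i,n+m}$ for all $n,m\ge 0$ (Gaussian binomial coefficients, as polynomials over $\mathbb Z$ evaluated at $q_i$); for each $r\in A_{i-1}$ one has $d_{i,n}(r)=0$ for all large $n$; and $\sigma_l\circ d_{i,n}=\lambda_{l,i}^n\,d_{i,n}\circ\sigma_l$ on $A_{i-1}$ for all $n\ge0$ and $i<l\le N$. Let $F=\mathrm{Frac}(A)$ be the division ring of fractions of $A$. Define sequences $(X^{(j)}_1,\dots,X^{(j)}_N)$ in $F$ for $j=N+1,N,\dots,2$ as follows. Put $X^{(N+1)}_l:=X_l$. For $2\le j\le N$, given $(x_1,\dots,x_N):=(X^{(j+1)}_1,\dots,X^{(j+1)}_N)$, let $\varphi_j:A_{j-1}\to\mathbb K\langle x_1,\dots,x_{j-1}\rangle$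 be the $\mathbb K$-algebra isomorphism with $\varphi_j(X_l)=x_l$ for all $l<j$, and put $$X^{(j)}_l:=\begin{cases}x_l,& l\ge j,\\ \displaystyle\sum_{n=0}^\infty q_j^{\frac{n(n+1)}2}(q_j-1)^{-n}\,\varphi_j\big(d_{j,n}(\sigma_j^{-n}(X_l))\big)\,x_j^{-n},& l<j\end{cases}$$ (the sum is finite). Then this construction is well defined: at every step the isomorphism $\varphi_j$ exists. Moreover, with $T_i:=X^{(2)}_i$, the subalgebra $A':=A^{(2)}:=\mathbb K\langle T_1,\dots,T_N\rangle$ of $F$ is the quantum affine space $$A'=\mathbb K_\Lambda[T_1,\dots,T_N],$$ i.e. the iterated Ore extension $\mathbb K[T_1][T_2;\sigma'_2]\cdots[T_N;\sigma'_N]$ with zero skew-derivations and $\sigma'_i(T_l)=\lambda_{i,l}T_l$ for all $1\le l<i\le N$, with the same matrix $\Lambda$ as above. -/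

import Mathlib

namespace DeletingDerivations

/-! ### Ore extensions and iterated Ore extensions -/

section Ore

variable {K : Type*} [Field K] {B : Type*} [Ring B] [Algebra K B]

/-- A (left) `σ`-derivation of a `K`-algebra `R`: a `K`-linear map with
`δ (a b) = σ a * δ b + δ a * b`. -/
def IsSkewDerivation {R : Type*} [Ring R] [Algebra K R]
    (σ : R ≃ₐ[K] R) (δ : R →ₗ[K] R) : Prop :=
  ∀ a b : R, δ (a * b) = σ a * δ b + δ a * b

/-- `S = R[x; σ, δ]`, for subalgebras `R, S` of a `K`-algebra `B` and an element `x` of `B`: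
`R ⊆ S`, `x ∈ S`, `S` is a free left `R`-module with basis `1, x, x², …`, `δ` is a
`σ`-derivation of `R`, and `x r = σ r * x + δ r` for all `r` in `R`. -/
structure IsOreExtension (R S : Subalgebra K B) (x : B)
    (σ : R ≃ₐ[K] R) (δ : R →ₗ[K] R) : Prop where
  le : R ≤ S
  mem : x ∈ S
  skewDerivation : IsSkewDerivation σ δ
  commutation : ∀ r : R, x * (r : B) = (σ r : B) * x + (δ r : B)
  free : ∀ s ∈ S, ∃! p : ℕ →₀ R, s = p.sum fun n r => (r : B) * x ^ n

/-- The subalgebra `K⟨x_l : l < i⟩` generated by the first `i` members of the family `x`. -/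
def initialSubalgebra (K : Type*) [Field K] {B : Type*} [Ring B] [Algebra K B] {N : ℕ}
    (x : Fin N → B) (i : ℕ) : Subalgebra K B :=
  Algebra.adjoin K (x '' {l | (l : ℕ) < i})

/-- The generator `x_l`, `l < i`, as an element of `K⟨x_l : l < i⟩`. -/
def gen (K : Type*) [Field K] {B : Type*} [Ring B] [Algebra K B] {N : ℕ}
    (x : Fin N → B) {l i : Fin N} (h : l < i) : initialSubalgebra K x i :=
  ⟨x l, Algebra.subset_adjoin ⟨l, h, rfl⟩⟩

/-- `S = K[x_0][x_1; σ_1, δ_1]⋯[x_{N-1}; σ_{N-1}, δ_{N-1}]`, for a subalgebra `S` of a `K`-algebra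
`B` and elements `x_0, …, x_{N-1}` of `B`. (For `i = 0` the algebra `K⟨x_l : l < i⟩` is `K`, so
`σ_0` is the identity and `δ_0` is zero: the first extension is the polynomial ring `K[x_0]`.) -/
structure IsIteratedOreExtension {N : ℕ} (S : Subalgebra K B) (x : Fin N → B)
    (σ : ∀ i : Fin N, initialSubalgebra K x i ≃ₐ[K] initialSubalgebra K x i)
    (δ : ∀ i : Fin N, initialSubalgebra K x i →ₗ[K] initialSubalgebra K x i) : Prop where
  algebraMap_injective : Function.Injective (algebraMap K B)
  step : ∀ i : Fin N, IsOreExtension (initialSubalgebra K x i) (initialSubalgebra K x ((i : ℕ) + 1))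
    (x i) (σ i) (δ i)
  eq : initialSubalgebra K x N = S

/-- `S` is the quantum affine space `K_Λ[x_0, …, x_{N-1}]`: the iterated Ore extension
`K[x_0][x_1; σ_1]⋯[x_{N-1}; σ_{N-1}]` with zero derivations and with
`σ_i (x_l) = λ_{i,l} x_l` for `l < i`. -/
def IsQuantumAffineSpace {N : ℕ} (Λ : Matrix (Fin N) (Fin N) Kˣ)
    (S : Subalgebra K B) (x : Fin N → B) : Prop :=
  ∃ σ : ∀ i : Fin N, initialSubalgebra K x i ≃ₐ[K] initialSubalgebra K x i,
    IsIteratedOreExtension S x σ (fun _ => 0) ∧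
    ∀ (i l : Fin N) (h : l < i), σ i (gen K x h) = (Λ i l : K) • gen K x h

end Ore

/-! ### Higher skew-derivations -/

/-- The Gaussian binomial coefficient `(n choose k)_q`, the value at `q` of a polynomial over `ℤ`
(so it makes sense at roots of unity), through its Pascal rule. -/
def gaussBinom {K : Type*} [Field K] (q : K) : ℕ → ℕ → K
  | _, 0 => 1
  | 0, _ + 1 => 0
  | n + 1, k + 1 => gaussBinom q n k + q ^ (k + 1) * gaussBinom q n (k + 1)

section Higher

variable {K : Type*} [Field K] {R : Type*} [Ring R] [Algebra K R]

/-- `{d_n}` is a higher `q`-skew `σ`-derivation on `R` that extends `δ`. -/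
structure IsHigherSkewDerivation (q : K) (σ : R ≃ₐ[K] R) (δ : R →ₗ[K] R)
    (d : ℕ → R →ₗ[K] R) : Prop where
  zero : d 0 = LinearMap.id
  one : d 1 = δ
  mul : ∀ (n : ℕ) (r s : R),
    d n (r * s) = ∑ i ∈ Finset.range (n + 1), (σ ^ (n - i)) (d i r) * d (n - i) s
  skew : ∀ (n : ℕ) (r : R), d n (σ r) = q ^ n • σ (d n r)

/-- `{d_n}` is locally nilpotent: each element is killed by all but finitely many `d_n`. (The
nilpotence index of a nonzero element is then the least admissible `m`.) -/
def IsLocallyNilpotent (d : ℕ → R →ₗ[K] R) : Prop :=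
  ∀ r : R, ∃ m : ℕ, ∀ n, m ≤ n → d n r = 0

/-- `{d_n}` is iterative. -/
def IsIterative (q : K) (d : ℕ → R →ₗ[K] R) : Prop :=
  ∀ (n m : ℕ) (r : R), d n (d m r) = gaussBinom q (n + m) m • d (n + m) r

end Higher

/-! ### Quantum nilpotent algebras -/

/-- A presentation of the `K`-algebra `A` as a quantum nilpotent algebra
`K[X_0][X_1; σ_1, δ_1]⋯[X_{N-1}; σ_{N-1}, δ_{N-1}]`. The indices start at `0`; the values
`q 0` and `d 0` are not used. -/
structure QuantumNilpotentAlgebra (K : Type*) [Field K] (A : Type*) [Ring A] [Algebra K A]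
    (N : ℕ) where
  /-- the indeterminates -/
  X : Fin N → A
  /-- the automorphisms -/
  σ : ∀ i : Fin N, initialSubalgebra K X i ≃ₐ[K] initialSubalgebra K X i
  /-- the skew-derivations -/
  δ : ∀ i : Fin N, initialSubalgebra K X i →ₗ[K] initialSubalgebra K X i
  /-- the matrix of the scalars `λ_{i,l}` -/
  Λ : Matrix (Fin N) (Fin N) Kˣ
  /-- the scalars `q_i` -/
  q : Fin N → Kˣ
  /-- the higher skew-derivations `{d_{i,n}}_n` -/
  d : ∀ i : Fin N, ℕ → initialSubalgebra K X i →ₗ[K] initialSubalgebra K X i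
  isIteratedOreExtension : IsIteratedOreExtension (⊤ : Subalgebra K A) X σ δ
  σ_gen : ∀ (i l : Fin N) (h : l < i), σ i (gen K X h) = (Λ i l : K) • gen K X h
  antisymm : ∀ i l : Fin N, Λ i l = (Λ l i)⁻¹
  q_ne_one : ∀ i : Fin N, 0 < (i : ℕ) → q i ≠ 1
  q_skew : ∀ i : Fin N, 0 < (i : ℕ) → ∀ r, δ i (σ i r) = (q i : K) • σ i (δ i r)
  higher : ∀ i : Fin N, 0 < (i : ℕ) → IsHigherSkewDerivation (q i : K) (σ i) (δ i) (d i)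
  locallyNilpotent : ∀ i : Fin N, 0 < (i : ℕ) → IsLocallyNilpotent (d i)
  iterative : ∀ i : Fin N, 0 < (i : ℕ) → IsIterative (q i : K) (d i)
  /-- `σ_l ∘ d_{i,n} = λ_{l,i}^n d_{i,n} ∘ σ_l` on `A_i = K⟨X_k : k < i⟩` for `i < l`. By `σ_gen`
  the automorphism `σ_l` maps `A_i` to itself; `r'` below is `σ_l r` as an element of `A_i`, and
  `e`, `e'` are `r` and `d_{i,n} r` as elements of `A_l`. -/
  σ_d : ∀ i l : Fin N, 0 < (i : ℕ) → i < l → ∀ (n : ℕ) (r r' : initialSubalgebra K X i)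
    (e e' : initialSubalgebra K X l), (e : A) = r → (e' : A) = d i n r → (σ l e : A) = r' →
    (σ l e' : A) = (Λ l i : K) ^ n • (d i n r' : A)

/-! ### The deleting derivations algorithm -/

/-- The division ring `F` is, through `ι`, the division ring of fractions of `A`: `ι` is an
embedding and every element of `F` is a fraction `a s⁻¹` with `a, s ∈ A`, `s ≠ 0`. -/
structure IsDivisionRingOfFractions {K : Type*} [Field K] {A : Type*} [Ring A] [Algebra K A]
    {F : Type*} [DivisionRing F] [Algebra K F] (ι : A →ₐ[K] F) : Prop where
  injective : Function.Injective ι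
  exists_fraction : ∀ f : F, ∃ a s : A, s ≠ 0 ∧ f = ι a * (ι s)⁻¹

/-- The sequences `Y j = (X_i^{(j)})_i`, `j = N + 1, N, …, 2`, in `F` are produced from `A` by the
deleting derivations algorithm.

The indeterminate with index `j : Fin N` is the `(j+1)`-st one, so the step that deletes `δ_j`
leads from `x = Y (j + 2)` to `y = Y (j + 1)`. The formula for `y_l` uses the maps `d_{j,n}` and
`σ_j` on `K⟨x_l : l < j⟩`, which are those on `K⟨X_l : l < j⟩` carried over by the isomorphism
`φ` with `X_l ↦ x_l`: the element `d_{j,n} (σ_j⁻ⁿ (x_l))` is `φ (d_{j,n} (σ_j⁻ⁿ (X_l)))`. That `φ`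
exists is a part of this definition; it is unique, as it is given on generators. -/
structure IsDeletingDerivations {K : Type*} [Field K] {A : Type*} [Ring A] [Algebra K A] {N : ℕ}
    (D : QuantumNilpotentAlgebra K A N) {F : Type*} [DivisionRing F] [Algebra K F]
    (ι : A →ₐ[K] F) (Y : ℕ → Fin N → F) : Prop where
  start : ∀ l : Fin N, Y (N + 1) l = ι (D.X l)
  step_ge : ∀ j : Fin N, 0 < (j : ℕ) → ∀ l : Fin N, j ≤ l → Y ((j : ℕ) + 1) l = Y ((j : ℕ) + 2) l
  step_lt : ∀ j : Fin N, 0 < (j : ℕ) →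
    ∃ φ : initialSubalgebra K D.X j ≃ₐ[K] initialSubalgebra K (Y ((j : ℕ) + 2)) j,
      (∀ (l : Fin N) (h : l < j), φ (gen K D.X h) = gen K (Y ((j : ℕ) + 2)) h) ∧
      ∀ (l : Fin N) (h : l < j),
        Y ((j : ℕ) + 1) l = ∑ᶠ n : ℕ,
          ((D.q j : K) ^ (n * (n + 1) / 2) * (((D.q j : K) - 1) ^ n)⁻¹) •
            ((φ (D.d j n (((D.σ j).symm ^ n) (gen K D.X h))) : F) * (Y ((j : ℕ) + 2) j)⁻¹ ^ n)

end DeletingDerivations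

/-!
One step of the algorithm replaces `R[x; σ, δ]` by `R[x; σ]` inside a division ring. The deletion
map `θ(r) = ∑ₙ cₙ dₙ(σ⁻ⁿ r) x⁻ⁿ`, with `cₙ = q^{n(n+1)/2} (q - 1)^{-n}`, satisfies
`x θ(r) = θ(σ r) x`: the iteration rule `δ dₙ = [n + 1]_q dₙ₊₁` and `cₙ [n + 1]_q =
cₙ₊₁ (1 - q^{-n-1})` make the difference of the two sides telescope (`mul_deletion`). Given this,
multiplicativity of `θ` is the Leibniz rule for `d` together with
`cₘ₊ₙ = q^{mn} cₘ cₙ` (`deletion_mul`). Since `θ(r) = r +` lower powers of `x`, a comparison of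
leading terms shows that the powers of `x` stay left independent over `θ(R)`, and in particular
that `θ` is injective (`eq_zero_of_sum_deletion_mul_pow`).

For the induction, iterated Ore extensions inside the division ring `F` are described without
mention of their automorphisms, which are conjugations: `IsPartialDeletion D m x` says that
`K⟨x_l : l < m⟩` is a copy of `K⟨X_l : l < m⟩` and that every later `x_i` commutes with its
predecessors up to the scalars `λ_{i,l}` and has left independent powers over the subalgebra they
generate. The step for `j` takes this property from `j + 1` to `j` (`IsPartialDeletion.of_deletion`):
`θ` gives the new copy, the relation between `σ_i` and `d_{j,n}` preserves the scalars, and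
left independence for `i > j` is preserved because multiplication by a power of `x_j` moves elements
of the new subalgebra into the old one (`linearIndependent_pow_adjoin`). The copy at each stage is
the isomorphism that the algorithm needs, and at `m = 1` the property is that of a quantum affine
space.
-/

namespace DeletingDerivations

/-! ### The deletion map -/

section Deletion

variable {K : Type*} [Field K] {R : Type*} [Ring R] [Algebra K R]
  {F : Type*} [DivisionRing F] [Algebra K F]

theorem gaussBinom_eq_zero_of_lt (q : K) : ∀ {n k : ℕ}, n < k → gaussBinom q n k = 0
  | _, 0, h => absurd h (Nat.not_lt_zero _)
  | 0, _ + 1, _ => by rw [gaussBinom]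
  | n + 1, k + 1, h => by
    rw [gaussBinom, gaussBinom_eq_zero_of_lt q (n := n) (k := k) (by omega),
      gaussBinom_eq_zero_of_lt q (n := n) (k := k + 1) (by omega)]
    simp

theorem gaussBinom_self (q : K) : ∀ n : ℕ, gaussBinom q n n = 1
  | 0 => by rw [gaussBinom]
  | n + 1 => by
    rw [gaussBinom, gaussBinom_self q n, gaussBinom_eq_zero_of_lt q (Nat.lt_succ_self n)]
    simp

theorem gaussBinom_succ_self_mul (q : K) : ∀ n : ℕ,
    gaussBinom q (n + 1) n * (q - 1) = q ^ (n + 1) - 1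
  | 0 => by rw [gaussBinom]; simp
  | n + 1 => by
    rw [gaussBinom, add_mul, gaussBinom_succ_self_mul q n, gaussBinom_self]
    ring

/-- The coefficient `q^{n(n+1)/2} (q - 1)^{-n}`. -/
def deletionCoeff (q : K) (n : ℕ) : K :=
  q ^ (n * (n + 1) / 2) * ((q - 1) ^ n)⁻¹

theorem deletionCoeff_zero (q : K) : deletionCoeff q 0 = 1 := by simp [deletionCoeff]

theorem deletionCoeff_add (q : K) (m n : ℕ) :
    deletionCoeff q (m + n) = q ^ (m * n) * (deletionCoeff q m * deletionCoeff q n) := by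
  have h : (m + n) * (m + n + 1) / 2 = m * n + m * (m + 1) / 2 + n * (n + 1) / 2 := by
    obtain ⟨a, ha⟩ := even_iff_two_dvd.mp (Nat.even_mul_succ_self m)
    obtain ⟨b, hb⟩ := even_iff_two_dvd.mp (Nat.even_mul_succ_self n)
    have : (m + n) * (m + n + 1) = 2 * (m * n + a + b) := by
      calc (m + n) * (m + n + 1) = 2 * (m * n) + m * (m + 1) + n * (n + 1) := by ring
        _ = _ := by rw [ha, hb]; ring
    rw [ha, hb, this]
    simp
  rw [deletionCoeff, h, deletionCoeff, deletionCoeff, pow_add, pow_add, pow_add, mul_inv]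
  ring

theorem deletionCoeff_mul_gaussBinom {q : K} (hq : q ≠ 0) (hq1 : q ≠ 1) (n : ℕ) :
    deletionCoeff q n * gaussBinom q (n + 1) n =
      deletionCoeff q (n + 1) * (1 - (q ^ (n + 1))⁻¹) := by
  have h1 : q - 1 ≠ 0 := sub_ne_zero.mpr hq1
  have hg : gaussBinom q (n + 1) n = (q ^ (n + 1) - 1) * (q - 1)⁻¹ := by
    rw [← gaussBinom_succ_self_mul, mul_assoc, mul_inv_cancel₀ h1, mul_one]
  have h2 : deletionCoeff q 1 = q * (q - 1)⁻¹ := by simp [deletionCoeff]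
  rw [hg, deletionCoeff_add, h2]
  field_simp
  ring

/-- The data of one deletion step inside the division ring `F`: an element `x ≠ 0` acts on the
image of `R` as the indeterminate of `R[x; σ, δ]`, and `δ` extends to a locally nilpotent
iterative higher `q`-skew `σ`-derivation `d` of `R`. -/
structure IsDeletionDatum (ψ : R →ₐ[K] F) (x : F) (q : K) (σ : R ≃ₐ[K] R) (δ : R →ₗ[K] R)
    (d : ℕ → R →ₗ[K] R) : Prop where
  x_ne_zero : x ≠ 0
  q_ne_zero : q ≠ 0
  q_ne_one : q ≠ 1
  commutation : ∀ r, x * ψ r = ψ (σ r) * x + ψ (δ r)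
  higher : IsHigherSkewDerivation q σ δ d
  locallyNilpotent : IsLocallyNilpotent d
  iterative : IsIterative q d

/-- The deletion map `r ↦ ∑ₙ q^{n(n+1)/2} (q - 1)^{-n} ψ(dₙ(σ⁻ⁿ r)) x⁻ⁿ`. -/
noncomputable def deletion (ψ : R →ₐ[K] F) (x : F) (q : K) (σ : R ≃ₐ[K] R)
    (d : ℕ → R →ₗ[K] R) (r : R) : F :=
  ∑ᶠ n : ℕ, deletionCoeff q n • (ψ (d n ((σ.symm ^ n) r)) * x⁻¹ ^ n)

theorem IsHigherSkewDerivation.skew_pow {q : K} {σ : R ≃ₐ[K] R} {δ : R →ₗ[K] R}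
    {d : ℕ → R →ₗ[K] R} (h : IsHigherSkewDerivation q σ δ d) (n m : ℕ) (r : R) :
    d n ((σ ^ m) r) = q ^ (n * m) • (σ ^ m) (d n r) := by
  induction m generalizing r with
  | zero => simp
  | succ m ih =>
    rw [pow_succ, AlgEquiv.mul_apply, AlgEquiv.mul_apply, ih, h.skew, map_smul, smul_smul,
      ← pow_add, Nat.mul_succ]

theorem pow_apply_symm_pow_apply (σ : R ≃ₐ[K] R) (n : ℕ) (r : R) :
    (σ ^ n) ((σ.symm ^ n) r) = r := by
  have : σ.symm = σ⁻¹ := rfl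
  rw [this, ← AlgEquiv.mul_apply, inv_pow, mul_inv_cancel, AlgEquiv.one_apply]

theorem symm_pow_succ_apply (σ : R ≃ₐ[K] R) (n : ℕ) (r : R) :
    (σ.symm ^ (n + 1)) (σ r) = (σ.symm ^ n) r := by
  rw [pow_succ, AlgEquiv.mul_apply, AlgEquiv.symm_apply_apply]

namespace IsDeletionDatum

variable {ψ : R →ₐ[K] F} {x : F} {q : K} {σ : R ≃ₐ[K] R} {δ : R →ₗ[K] R} {d : ℕ → R →ₗ[K] R}

theorem exists_forall_eq_zero (h : IsDeletionDatum ψ x q σ δ d) (r : R) :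
    ∃ M, ∀ n, M ≤ n → d n ((σ.symm ^ n) r) = 0 := by
  obtain ⟨M, hM⟩ := h.locallyNilpotent r
  refine ⟨M, fun n hn => ?_⟩
  have h1 := h.higher.skew_pow n n ((σ.symm ^ n) r)
  rw [pow_apply_symm_pow_apply, hM n hn] at h1
  have h2 := (smul_eq_zero.mp h1.symm).resolve_left (pow_ne_zero _ h.q_ne_zero)
  exact (map_eq_zero_iff _ (σ ^ n).injective).mp h2

/-- Any bound on the nonzero terms turns the deletion map into a finite sum, so that several values
can be written over a common range. -/
theorem deletion_eq_sum {r : R} {M : ℕ} (hM : ∀ n, M ≤ n → d n ((σ.symm ^ n) r) = 0) :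
    deletion ψ x q σ d r =
      ∑ n ∈ Finset.range M, deletionCoeff q n • (ψ (d n ((σ.symm ^ n) r)) * x⁻¹ ^ n) := by
  refine finsum_eq_sum_of_support_subset _ fun n hn => ?_
  rw [Finset.coe_range, Set.mem_Iio]
  by_contra hlt
  refine hn ?_
  dsimp only
  rw [hM n (not_lt.mp hlt), map_zero, zero_mul, smul_zero]

theorem exists_deletion_eq_sum (h : IsDeletionDatum ψ x q σ δ d) (r : R) : ∃ M, ∀ n, M ≤ n →
    deletion ψ x q σ d r =
      ∑ k ∈ Finset.range n, deletionCoeff q k • (ψ (d k ((σ.symm ^ k) r)) * x⁻¹ ^ k) := by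
  obtain ⟨M, hM⟩ := h.exists_forall_eq_zero r
  exact ⟨M, fun n hn => deletion_eq_sum fun k hk => hM k (hn.trans hk)⟩

theorem deletion_add (h : IsDeletionDatum ψ x q σ δ d) (r s : R) :
    deletion ψ x q σ d (r + s) = deletion ψ x q σ d r + deletion ψ x q σ d s := by
  obtain ⟨M₁, h₁⟩ := h.exists_deletion_eq_sum r
  obtain ⟨M₂, h₂⟩ := h.exists_deletion_eq_sum s
  obtain ⟨M₃, h₃⟩ := h.exists_deletion_eq_sum (r + s)
  let M := max M₁ (max M₂ M₃)
  rw [h₁ M (by simp [M]), h₂ M (by simp [M]), h₃ M (by simp [M]), ← Finset.sum_add_distrib]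
  refine Finset.sum_congr rfl fun n _ => ?_
  rw [map_add, map_add, map_add, add_mul, smul_add]

theorem deletion_smul (h : IsDeletionDatum ψ x q σ δ d) (c : K) (r : R) :
    deletion ψ x q σ d (c • r) = c • deletion ψ x q σ d r := by
  obtain ⟨M₁, h₁⟩ := h.exists_deletion_eq_sum r
  obtain ⟨M₂, h₂⟩ := h.exists_deletion_eq_sum (c • r)
  let M := max M₁ M₂
  rw [h₁ M (by simp [M]), h₂ M (by simp [M]), Finset.smul_sum]
  refine Finset.sum_congr rfl fun n _ => ?_
  rw [map_smul, map_smul, map_smul, smul_mul_assoc, smul_comm]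

/-- The deletion map turns the skew-derivation off: `x` acts on its image through `σ` alone. -/
theorem mul_deletion (h : IsDeletionDatum ψ x q σ δ d) (r : R) :
    x * deletion ψ x q σ d r = deletion ψ x q σ d (σ r) * x := by
  obtain ⟨M₁, h₁⟩ := h.exists_forall_eq_zero r
  obtain ⟨M₂, h₂⟩ := h.exists_forall_eq_zero (σ r)
  let M := max M₁ M₂
  rw [deletion_eq_sum fun n (hn : M ≤ n) => h₁ n ((le_max_left _ _).trans hn),
    deletion_eq_sum fun n (hn : M ≤ n) => h₂ n ((le_max_right _ _).trans hn),
    Finset.mul_sum, Finset.sum_mul]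
  -- The two sums differ termwise by `U (n + 1) - U n`, and `U` vanishes at both ends.
  let U : ℕ → F := fun n => (deletionCoeff q n * (1 - (q ^ n)⁻¹)) •
    (ψ (d n ((σ.symm ^ n) (σ r))) * x⁻¹ ^ n * x)
  have hterm : ∀ n, x * (deletionCoeff q n • (ψ (d n ((σ.symm ^ n) r)) * x⁻¹ ^ n)) =
      deletionCoeff q n • (ψ (d n ((σ.symm ^ n) (σ r))) * x⁻¹ ^ n) * x + (U (n + 1) - U n) := by
    intro n
    have hσ : (σ.symm ^ n) (σ r) = σ ((σ.symm ^ n) r) := by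
      rw [← AlgEquiv.apply_symm_apply σ ((σ.symm ^ n) (σ r)), ← AlgEquiv.mul_apply σ.symm,
        ← pow_succ', symm_pow_succ_apply]
    have hx : x * x⁻¹ ^ n = x⁻¹ ^ n * x :=
      ((Commute.refl x).inv_right₀.pow_right n).eq
    have hU : U (n + 1) = deletionCoeff q n • (ψ (δ (d n ((σ.symm ^ n) r))) * x⁻¹ ^ n) := by
      simp only [U]
      rw [← h.higher.one, h.iterative, add_comm 1 n, map_smul, smul_mul_assoc, smul_smul,
        deletionCoeff_mul_gaussBinom h.q_ne_zero h.q_ne_one, symm_pow_succ_apply, pow_succ x⁻¹,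
        mul_assoc (ψ _), mul_assoc _ x⁻¹, inv_mul_cancel₀ h.x_ne_zero, mul_one]
    rw [hU]
    simp only [U]
    rw [hσ, h.higher.skew, mul_smul_comm, ← mul_assoc, h.commutation, add_mul, smul_add,
      mul_assoc _ x, hx, map_smul]
    simp only [smul_mul_assoc, smul_smul, mul_assoc, mul_sub, sub_mul, mul_one, sub_smul]
    rw [inv_mul_cancel₀ (pow_ne_zero n h.q_ne_zero), mul_one]
    abel
  simp_rw [hterm]
  rw [Finset.sum_add_distrib, Finset.sum_range_sub]
  have hU0 : U 0 = 0 := by simp [U]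
  have hUM : U M = 0 := by
    simp only [U]
    rw [h₂ M (le_max_right _ _), map_zero, zero_mul, zero_mul, smul_zero]
  rw [hU0, hUM, sub_zero, add_zero]

theorem inv_pow_mul_deletion (h : IsDeletionDatum ψ x q σ δ d) (n : ℕ) (r : R) :
    x⁻¹ ^ n * deletion ψ x q σ d r = deletion ψ x q σ d ((σ.symm ^ n) r) * x⁻¹ ^ n := by
  induction n with
  | zero => simp
  | succ n ih =>
    have h1 : x⁻¹ * deletion ψ x q σ d ((σ.symm ^ n) r) =
        deletion ψ x q σ d ((σ.symm ^ (n + 1)) r) * x⁻¹ := by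
      rw [inv_mul_eq_iff_eq_mul₀ h.x_ne_zero, ← mul_assoc, h.mul_deletion, mul_assoc,
        mul_inv_cancel₀ h.x_ne_zero, mul_one, pow_succ', AlgEquiv.mul_apply,
        AlgEquiv.apply_symm_apply]
    rw [pow_succ', mul_assoc, ih, ← mul_assoc, h1, mul_assoc, ← pow_succ', pow_succ']

/-- Multiplicativity: moving `x⁻ⁿ` past the second factor by `inv_pow_mul_deletion` makes the
product a double sum, which the Leibniz rule for `d` and the `q`-skew relation identify with the
sum for `r * s`. -/
theorem deletion_mul (h : IsDeletionDatum ψ x q σ δ d) (r s : R) :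
    deletion ψ x q σ d (r * s) = deletion ψ x q σ d r * deletion ψ x q σ d s := by
  obtain ⟨M₁, h₁⟩ := h.exists_forall_eq_zero r
  obtain ⟨M₂, h₂⟩ := h.locallyNilpotent s
  obtain ⟨M₃, h₃⟩ := h.exists_forall_eq_zero (r * s)
  have hnil : ∀ k n, M₂ ≤ n → d n ((σ.symm ^ k) s) = 0 := fun k n hn => by
    have h3 := h.higher.skew_pow n k ((σ.symm ^ k) s)
    rw [pow_apply_symm_pow_apply, h₂ n hn] at h3
    exact (map_eq_zero_iff _ (σ ^ k).injective).mp
      ((smul_eq_zero.mp h3.symm).resolve_left (pow_ne_zero _ h.q_ne_zero))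
  let M := max (M₁ + M₂) M₃
  let f : ℕ → ℕ → F := fun k m => (deletionCoeff q k * deletionCoeff q m) •
    (ψ (d k ((σ.symm ^ k) r)) * (ψ (d m ((σ.symm ^ (m + k)) s)) * x⁻¹ ^ (m + k)))
  have hl : deletion ψ x q σ d (r * s) =
      ∑ n ∈ Finset.range M, ∑ k ∈ Finset.range (n + 1), f k (n - k) := by
    rw [deletion_eq_sum fun n (hn : M ≤ n) => h₃ n ((le_max_right _ _).trans hn)]
    refine Finset.sum_congr rfl fun n _ => ?_
    rw [map_mul, h.higher.mul, map_sum, Finset.sum_mul, Finset.smul_sum]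
    refine Finset.sum_congr rfl fun k hk => ?_
    obtain ⟨m, rfl⟩ := Nat.exists_eq_add_of_le (Nat.lt_succ_iff.mp (Finset.mem_range.mp hk))
    rw [Nat.add_sub_cancel_left]
    have h3 := h.higher.skew_pow k m ((σ.symm ^ (k + m)) r)
    rw [add_comm k m, pow_add, AlgEquiv.mul_apply, pow_apply_symm_pow_apply,
      ← AlgEquiv.mul_apply, ← pow_add] at h3
    simp only [f]
    rw [h3, map_smul, deletionCoeff_add, add_comm k m, map_mul]
    simp only [smul_mul_assoc, smul_smul, mul_assoc]
    congr 1
    ring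
  have hr : deletion ψ x q σ d r * deletion ψ x q σ d s =
      ∑ k ∈ Finset.range M, ∑ m ∈ Finset.range (M - k), f k m := by
    rw [deletion_eq_sum fun n (hn : M ≤ n) =>
      h₁ n ((Nat.le_add_right _ _).trans ((le_max_left _ _).trans hn)), Finset.sum_mul]
    refine Finset.sum_congr rfl fun k _ => ?_
    rcases le_or_gt M₁ k with hk | hk
    · simp only [f]
      simp_rw [h₁ k hk, map_zero, zero_mul, smul_zero]
      rw [zero_mul, Finset.sum_const_zero]
    · have hMk : M₂ ≤ M - k := by
        have : M₁ + M₂ ≤ M := le_max_left _ _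
        omega
      rw [smul_mul_assoc, mul_assoc, h.inv_pow_mul_deletion,
        deletion_eq_sum (r := (σ.symm ^ k) s) fun n (hn : M - k ≤ n) => by
          rw [← AlgEquiv.mul_apply, ← pow_add]; exact hnil _ n (hMk.trans hn),
        Finset.sum_mul, Finset.mul_sum, Finset.smul_sum]
      refine Finset.sum_congr rfl fun m _ => ?_
      simp only [f]
      rw [← AlgEquiv.mul_apply, ← pow_add, smul_mul_assoc, mul_smul_comm, smul_smul, mul_assoc,
        ← pow_add]
  rw [hl, hr, Finset.sum_range_diag_flip]

end IsDeletionDatum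

end Deletion

/-! ### Left independence of powers -/

section Powers

variable {K : Type*} [Field K] {B : Type*} [Ring B] [Algebra K B]

theorem linearIndependent_pow_iff {S : Subalgebra K B} {x : B} :
    LinearIndependent S (fun n : ℕ => x ^ n) ↔ ∀ (n : ℕ) (g : ℕ → S),
      ∑ k ∈ Finset.range n, (g k : B) * x ^ k = 0 → ∀ k < n, g k = 0 := by
  rw [linearIndependent_iff']
  constructor
  · intro h n g hg k hk
    exact h (Finset.range n) g hg k (Finset.mem_range.mpr hk)
  · intro h s g hg k hk
    classical
    have hs : s ⊆ Finset.range (s.sup id + 1) := fun i hi =>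
      Finset.mem_range.mpr (Nat.lt_succ_of_le (Finset.le_sup (f := id) hi))
    have h1 := h (s.sup id + 1) (fun i => if i ∈ s then g i else 0) (by
      rw [← Finset.sum_subset hs]
      · rw [← hg]
        refine Finset.sum_congr rfl fun i hi => ?_
        simp [hi, Subalgebra.smul_def]
      · intro i _ hi
        simp [hi]) k (Finset.mem_range.mp (hs hk))
    simpa [hk] using h1

end Powers

section DeletionHom

variable {K : Type*} [Field K] {R : Type*} [Ring R] [Algebra K R]
  {F : Type*} [DivisionRing F] [Algebra K F]
  {ψ : R →ₐ[K] F} {x : F} {q : K} {σ : R ≃ₐ[K] R} {δ : R →ₗ[K] R} {d : ℕ → R →ₗ[K] R}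

namespace IsDeletionDatum

/-- Up to lower powers of `x`, the deletion map is `ψ`. -/
theorem exists_deletion_mul_pow_sub_mem (h : IsDeletionDatum ψ x q σ δ d) (r : R) :
    ∃ M, ∀ n, M ≤ n → deletion ψ x q σ d r * x ^ n - ψ r * x ^ n ∈
      Submodule.span ψ.range ((fun k : ℕ => x ^ k) '' Set.Iio n) := by
  obtain ⟨M, hM⟩ := h.exists_deletion_eq_sum r
  refine ⟨M + 1, fun n hn => ?_⟩
  obtain ⟨n, rfl⟩ : ∃ k, n = k + 1 := ⟨n - 1, by omega⟩
  rw [hM (n + 1) (by omega), Finset.sum_range_succ', add_mul, deletionCoeff_zero]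
  have h0 : (1 : K) • (ψ (d 0 ((σ.symm ^ 0) r)) * x⁻¹ ^ 0) * x ^ (n + 1) = ψ r * x ^ (n + 1) := by
    rw [h.higher.zero, pow_zero, pow_zero, one_smul, mul_one, LinearMap.id_apply,
      AlgEquiv.one_apply]
  rw [h0, add_sub_cancel_right, Finset.sum_mul]
  refine Submodule.sum_mem _ fun k hk => ?_
  have hk' : k + 1 ≤ n + 1 := by have := Finset.mem_range.mp hk; omega
  obtain ⟨m, hm⟩ := Nat.exists_eq_add_of_le hk'
  have hx : x⁻¹ ^ (k + 1) * x ^ (n + 1) = x ^ m := by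
    rw [hm, pow_add x, ← mul_assoc, inv_pow, inv_mul_cancel₀ (pow_ne_zero _ h.x_ne_zero), one_mul]
  rw [← smul_mul_assoc, mul_assoc, hx, ← map_smul]
  exact Submodule.smul_mem _ (⟨_, AlgHom.mem_range_self ψ _⟩ : ψ.range)
    (Submodule.subset_span ⟨m, by rw [Set.mem_Iio]; omega, rfl⟩)

theorem exists_deletion_mul_pow_mem (h : IsDeletionDatum ψ x q σ δ d) {S : Subalgebra K F}
    (hψ : ψ.range ≤ S) (hx : x ∈ S) (r : R) : ∃ M, deletion ψ x q σ d r * x ^ M ∈ S := by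
  obtain ⟨M, hM⟩ := h.exists_deletion_mul_pow_sub_mem r
  refine ⟨M, ?_⟩
  have h1 : ∀ f ∈ Submodule.span ψ.range ((fun k : ℕ => x ^ k) '' Set.Iio M), f ∈ S := by
    intro f hf
    induction hf using Submodule.span_induction with
    | mem f hf =>
      obtain ⟨k, -, rfl⟩ := hf
      exact pow_mem hx k
    | zero => exact zero_mem S
    | add f g _ _ hf hg => exact add_mem hf hg
    | smul a f _ hf => exact mul_mem (hψ a.2) hf
  have h2 := add_mem (h1 _ (hM M le_rfl))
    (mul_mem (hψ (AlgHom.mem_range_self ψ r)) (pow_mem hx M))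
  rwa [sub_add_cancel] at h2

/-- The powers of `x` remain left independent over the image of the deletion map: compare leading
terms after multiplication by a large power of `x`. -/
theorem eq_zero_of_sum_deletion_mul_pow (h : IsDeletionDatum ψ x q σ δ d)
    (hψ : Function.Injective ψ) (hx : LinearIndependent ψ.range (fun n : ℕ => x ^ n)) (L : ℕ)
    (r : ℕ → R) (hr : ∑ n ∈ Finset.range L, deletion ψ x q σ d (r n) * x ^ n = 0) :
    ∀ n < L, r n = 0 := by
  induction L with
  | zero => intro n hn; omega
  | succ L ih =>
    choose M hM using h.exists_deletion_mul_pow_sub_mem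
    let m := (Finset.range (L + 1)).sup fun n => M (r n)
    let V : ℕ → Submodule ψ.range F := fun t =>
      Submodule.span ψ.range ((fun k : ℕ => x ^ k) '' Set.Iio t)
    have hm : ∀ n, n ≤ L →
        deletion ψ x q σ d (r n) * x ^ (m + n) - ψ (r n) * x ^ (m + n) ∈ V (m + n) := by
      intro n hn
      refine hM (r n) (m + n) (le_trans ?_ (Nat.le_add_right m n))
      exact Finset.le_sup (f := fun n => M (r n)) (Finset.mem_range.mpr (Nat.lt_succ_of_le hn))
    have hlow : ∀ n, n < L → deletion ψ x q σ d (r n) * x ^ (m + n) ∈ V (m + L) := by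
      intro n hn
      have h1 : V (m + n) ≤ V (m + L) := Submodule.span_mono
        (Set.image_mono (Set.Iio_subset_Iio (by omega)))
      have h2 : ψ (r n) * x ^ (m + n) ∈ V (m + L) :=
        Submodule.smul_mem _ (⟨_, AlgHom.mem_range_self ψ _⟩ : ψ.range)
          (Submodule.subset_span ⟨m + n, by rw [Set.mem_Iio]; omega, rfl⟩)
      have h3 := add_mem (h1 (hm n hn.le)) h2
      rwa [sub_add_cancel] at h3
    have hsum : ∑ n ∈ Finset.range (L + 1), deletion ψ x q σ d (r n) * x ^ (m + n) = 0 := by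
      have h1 := congrArg (· * x ^ m) hr
      simp only [Finset.sum_mul, zero_mul] at h1
      rw [← h1]
      exact Finset.sum_congr rfl fun n _ => by rw [mul_assoc, ← pow_add, add_comm n m]
    rw [Finset.sum_range_succ] at hsum
    have htop : ψ (r L) * x ^ (m + L) ∈ V (m + L) := by
      have h1 : deletion ψ x q σ d (r L) * x ^ (m + L) ∈ V (m + L) := by
        rw [← neg_eq_of_add_eq_zero_right hsum]
        exact neg_mem (Submodule.sum_mem _ fun n hn => hlow n (Finset.mem_range.mp hn))
      have h2 := sub_mem h1 (hm L le_rfl)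
      rwa [sub_sub_cancel] at h2
    have hL : r L = 0 := by
      have hsub : Set.Iio (m + L) ⊆ Set.univ \ {m + L} :=
        Set.subset_sdiff_singleton (Set.subset_univ _) (lt_irrefl (m + L))
      have h1 := linearIndependent_iff_eq_zero_of_smul_mem_span.mp hx (m + L)
        (⟨_, AlgHom.mem_range_self ψ (r L)⟩ : ψ.range)
        (Submodule.span_mono (Set.image_mono hsub) htop)
      exact (map_eq_zero_iff ψ hψ).mp (congrArg Subtype.val h1)
    intro n hn
    rcases Nat.lt_succ_iff_lt_or_eq.mp hn with hn | rfl
    · refine ih ?_ n hn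
      have h0 : deletion ψ x q σ d (0 : R) = 0 := by
        have := h.deletion_smul 0 (0 : R)
        rwa [zero_smul, zero_smul] at this
      rwa [Finset.sum_range_succ, hL, h0, zero_mul, add_zero] at hr
    · exact hL

theorem deletion_injective (h : IsDeletionDatum ψ x q σ δ d)
    (hψ : Function.Injective ψ) (hx : LinearIndependent ψ.range (fun n : ℕ => x ^ n)) :
    Function.Injective (deletion ψ x q σ d) := by
  intro r s hrs
  have h1 : deletion ψ x q σ d (r - s) = 0 := by
    have h2 := h.deletion_add (r - s) s
    rw [sub_add_cancel, hrs] at h2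
    exact right_eq_add.mp h2
  exact sub_eq_zero.mp
    (h.eq_zero_of_sum_deletion_mul_pow hψ hx 1 (fun _ => r - s) (by simpa using h1) 0 one_pos)

theorem deletion_one (h : IsDeletionDatum ψ x q σ δ d)
    (hψ : Function.Injective ψ) (hx : LinearIndependent ψ.range (fun n : ℕ => x ^ n)) :
    deletion ψ x q σ d 1 = 1 := by
  have hR : (1 : R) ≠ 0 := fun h0 => one_ne_zero (α := F) (by
    rw [← map_one ψ, h0, map_zero])
  have h1 := h.deletion_mul 1 1
  rw [mul_one] at h1
  refine (mul_eq_left₀ fun h0 => hR (h.deletion_injective hψ hx ?_)).mp h1.symm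
  have := h.deletion_smul 0 (0 : R)
  rw [zero_smul, zero_smul] at this
  rw [h0, this]

/-- The deletion map as an algebra homomorphism. -/
noncomputable def deletionHom (h : IsDeletionDatum ψ x q σ δ d)
    (hψ : Function.Injective ψ) (hx : LinearIndependent ψ.range (fun n : ℕ => x ^ n)) :
    R →ₐ[K] F :=
  AlgHom.ofLinearMap
    { toFun := deletion ψ x q σ d
      map_add' := h.deletion_add
      map_smul' := h.deletion_smul } (h.deletion_one hψ hx) h.deletion_mul

theorem deletionHom_apply (h : IsDeletionDatum ψ x q σ δ d)
    (hψ : Function.Injective ψ) (hx : LinearIndependent ψ.range (fun n : ℕ => x ^ n)) (r : R) :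
    h.deletionHom hψ hx r = deletion ψ x q σ d r := rfl

theorem linearIndependent_pow_range_deletionHom (h : IsDeletionDatum ψ x q σ δ d)
    (hψ : Function.Injective ψ) (hx : LinearIndependent ψ.range (fun n : ℕ => x ^ n)) :
    LinearIndependent (h.deletionHom hψ hx).range (fun n : ℕ => x ^ n) := by
  rw [linearIndependent_pow_iff]
  intro n g hg k hk
  choose r hr using fun k => (AlgHom.mem_range _).mp (g k).2
  have h1 := h.eq_zero_of_sum_deletion_mul_pow hψ hx n r (by
    rw [← hg]
    exact Finset.sum_congr rfl fun k _ => by rw [← hr k, deletionHom_apply]) k hk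
  refine Subtype.ext ?_
  rw [← hr k, h1, map_zero, ZeroMemClass.coe_zero]

end IsDeletionDatum

end DeletionHom

/-! ### Initial subalgebras -/

section Initial

variable {K : Type*} [Field K] {B C : Type*} [Ring B] [Algebra K B] [Ring C] [Algebra K C] {N : ℕ}

theorem mem_initialSubalgebra (x : Fin N → B) {i : ℕ} {l : Fin N} (h : (l : ℕ) < i) :
    x l ∈ initialSubalgebra K x i :=
  Algebra.subset_adjoin ⟨l, h, rfl⟩

@[elab_as_elim]
theorem initialSubalgebra_induction {x : Fin N → B} {i : ℕ} {p : initialSubalgebra K x i → Prop}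
    (mem : ∀ (l : Fin N) (h : (l : ℕ) < i), p ⟨x l, mem_initialSubalgebra x h⟩)
    (algebraMap : ∀ c : K, p (algebraMap K _ c))
    (add : ∀ a b, p a → p b → p (a + b)) (mul : ∀ a b, p a → p b → p (a * b))
    (a : initialSubalgebra K x i) : p a := by
  obtain ⟨a, ha⟩ := a
  refine Algebra.adjoin_induction (p := fun a ha => p ⟨a, ha⟩) ?_ algebraMap
    (fun a b _ _ => add _ _) (fun a b _ _ => mul _ _) ha
  rintro _ ⟨l, hl, rfl⟩
  exact mem l hl

theorem initialSubalgebra_mono (x : Fin N → B) {i j : ℕ} (h : i ≤ j) :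
    initialSubalgebra K x i ≤ initialSubalgebra K x j :=
  Algebra.adjoin_mono (Set.image_mono fun _ hl => lt_of_lt_of_le hl h)

theorem initialSubalgebra_eq_adjoin_range (x : Fin N → B) :
    initialSubalgebra K x N = Algebra.adjoin K (Set.range x) := by
  rw [initialSubalgebra, ← Set.image_univ]
  congr
  ext l
  simp

theorem initialSubalgebra_succ (x : Fin N → B) (i : Fin N) :
    initialSubalgebra K x ((i : ℕ) + 1) =
      Algebra.adjoin K (insert (x i) (x '' {l | (l : ℕ) < i})) := by
  have h : {l : Fin N | (l : ℕ) < (i : ℕ) + 1} = insert i {l : Fin N | (l : ℕ) < i} := by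
    ext l
    rw [Set.mem_insert_iff, Fin.ext_iff]
    exact Nat.lt_succ_iff_lt_or_eq.trans or_comm
  rw [initialSubalgebra, h, Set.image_insert_eq]

theorem range_eq_initialSubalgebra {x : Fin N → B} {y : Fin N → C} {i : ℕ}
    {f : initialSubalgebra K x i →ₐ[K] C}
    (hf : ∀ (l : Fin N) (h : (l : ℕ) < i), f ⟨x l, mem_initialSubalgebra x h⟩ = y l) :
    f.range = initialSubalgebra K y i := by
  have htop : (⊤ : Subalgebra K (initialSubalgebra K x i)) =
      Algebra.adjoin K ((↑) ⁻¹' (x '' {l | (l : ℕ) < i})) :=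
    Algebra.adjoin_adjoin_coe_preimage.symm
  rw [← Algebra.map_top, htop, AlgHom.map_adjoin]
  change _ = Algebra.adjoin K _
  congr 1
  ext c
  constructor
  · rintro ⟨⟨_, hb⟩, ⟨l, hl, rfl⟩, rfl⟩
    exact ⟨l, hl, (hf l hl).symm⟩
  · rintro ⟨l, hl, rfl⟩
    exact ⟨⟨x l, mem_initialSubalgebra x hl⟩, ⟨l, hl, rfl⟩, hf l hl⟩

theorem algHom_ext_initialSubalgebra {x : Fin N → B} {i : ℕ}
    {f g : initialSubalgebra K x i →ₐ[K] C}
    (hfg : ∀ (l : Fin N) (h : (l : ℕ) < i),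
      f ⟨x l, mem_initialSubalgebra x h⟩ = g ⟨x l, mem_initialSubalgebra x h⟩) : f = g := by
  refine AlgHom.ext_of_adjoin_eq_top Algebra.adjoin_adjoin_coe_preimage ?_
  rintro ⟨_, hb⟩ ⟨l, hl, rfl⟩
  exact hfg l hl

theorem IsOreExtension.linearIndependent_pow {R S : Subalgebra K B} {x : B} {σ : R ≃ₐ[K] R}
    {δ : R →ₗ[K] R} (h : IsOreExtension R S x σ δ) :
    LinearIndependent R (fun n : ℕ => x ^ n) := by
  rw [linearIndependent_iff]
  intro p hp
  obtain ⟨p₀, -, hu⟩ := h.free 0 (zero_mem S)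
  rw [hu p (by rw [← hp]; rfl), hu 0 Finsupp.sum_zero_index.symm]

end Initial

/-! ### Quantum affine spaces in division rings -/

section Quantum

variable {K : Type*} [Field K] {F : Type*} [DivisionRing F] [Algebra K F]

/-- Conjugation by a nonzero element of a division ring. -/
def conjugation (K : Type*) [Field K] {F : Type*} [DivisionRing F] [Algebra K F] (x : F)
    (hx : x ≠ 0) : F ≃ₐ[K] F :=
  AlgEquiv.ofAlgHom
    (AlgHom.ofLinearMap ((LinearMap.mulRight K x⁻¹).comp (LinearMap.mulLeft K x))
      (by simp [hx]) (fun a b => by simp [mul_assoc, hx]))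
    (AlgHom.ofLinearMap ((LinearMap.mulRight K x).comp (LinearMap.mulLeft K x⁻¹))
      (by simp [hx]) (fun a b => by simp [mul_assoc, hx]))
    (by ext a; simp [mul_assoc, hx]) (by ext a; simp [mul_assoc, hx])

theorem conjugation_apply {x : F} (hx : x ≠ 0) (a : F) :
    conjugation K x hx a = x * a * x⁻¹ := rfl

theorem map_conjugation_adjoin {x : F} (hx : x ≠ 0) {G : Set F}
    (hG : ∀ g ∈ G, ∃ c : Kˣ, x * g = (c : K) • (g * x)) :
    (Algebra.adjoin K G).map (conjugation K x hx : F →ₐ[K] F) = Algebra.adjoin K G := by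
  have hconj : ∀ g ∈ G, ∃ c : Kˣ, conjugation K x hx g = (c : K) • g := by
    intro g hg
    obtain ⟨c, hc⟩ := hG g hg
    exact ⟨c, by rw [conjugation_apply, hc, smul_mul_assoc, mul_assoc, mul_inv_cancel₀ hx,
      mul_one]⟩
  rw [AlgHom.map_adjoin]
  refine le_antisymm (Algebra.adjoin_le ?_) (Algebra.adjoin_le fun g hg => ?_)
  · rintro _ ⟨g, hg, rfl⟩
    obtain ⟨c, hc⟩ := hconj g hg
    exact hc ▸ Subalgebra.smul_mem _ (Algebra.subset_adjoin hg) _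
  · obtain ⟨c, hc⟩ := hconj g hg
    have h1 : g = ((c⁻¹ : Kˣ) : K) • conjugation K x hx g := by
      rw [hc, smul_smul, Units.inv_mul, one_smul]
    rw [SetLike.mem_coe, h1]
    exact Subalgebra.smul_mem _ (Algebra.subset_adjoin (Set.mem_image_of_mem _ hg)) _

/-- The automorphism of `S` induced by conjugation by `x`, when conjugation preserves `S`. -/
def conjugationOn {x : F} (hx : x ≠ 0) {S : Subalgebra K F}
    (hS : S.map (conjugation K x hx : F →ₐ[K] F) = S) : S ≃ₐ[K] S :=
  ((conjugation K x hx).subalgebraMap S).trans (Subalgebra.equivOfEq _ _ hS)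

theorem coe_conjugationOn {x : F} (hx : x ≠ 0) {S : Subalgebra K F}
    (hS : S.map (conjugation K x hx : F →ₐ[K] F) = S) (s : S) :
    (conjugationOn hx hS s : F) = x * s * x⁻¹ := rfl

theorem conjugationOn_mul_self {x : F} (hx : x ≠ 0) {S : Subalgebra K F}
    (hS : S.map (conjugation K x hx : F →ₐ[K] F) = S) (s : S) :
    (conjugationOn hx hS s : F) * x = x * s := by
  rw [coe_conjugationOn, mul_assoc, inv_mul_cancel₀ hx, mul_one]

theorem isOreExtension_adjoin_insert {x : F} (hx : x ≠ 0) {G : Set F}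
    (hG : (Algebra.adjoin K G).map (conjugation K x hx : F →ₐ[K] F) = Algebra.adjoin K G)
    (hli : LinearIndependent (Algebra.adjoin K G) (fun n : ℕ => x ^ n)) :
    IsOreExtension (Algebra.adjoin K G) (Algebra.adjoin K (insert x G)) x
      (conjugationOn hx hG) 0 where
  le := Algebra.adjoin_mono (Set.subset_insert x G)
  mem := Algebra.subset_adjoin (Set.mem_insert x G)
  skewDerivation := fun a b => by simp
  commutation := fun r => by
    rw [conjugationOn_mul_self, LinearMap.zero_apply, ZeroMemClass.coe_zero, add_zero]
  free := by
    intro s hs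
    let V := Submodule.span (Algebra.adjoin K G) (Set.range fun n : ℕ => x ^ n)
    have hmul : ∀ v ∈ V, s * v ∈ V := by
      induction hs using Algebra.adjoin_induction with
      | mem g hg =>
        intro v hv
        rcases hg with rfl | hg
        · induction hv using Submodule.span_induction with
          | mem v hv =>
            obtain ⟨n, rfl⟩ := hv
            exact Submodule.subset_span ⟨n + 1, pow_succ' _ _⟩
          | zero => rw [mul_zero]; exact zero_mem V
          | add v w _ _ hv hw => rw [mul_add]; exact add_mem hv hw
          | smul a v _ hv =>
            rw [Subalgebra.smul_def, smul_eq_mul, ← mul_assoc, ← conjugationOn_mul_self hx hG,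
              mul_assoc]
            exact Submodule.smul_mem V (conjugationOn hx hG a) hv
        · exact Submodule.smul_mem V (⟨g, Algebra.subset_adjoin hg⟩ : Algebra.adjoin K G) hv
      | algebraMap c =>
        intro v hv
        exact Submodule.smul_mem V (algebraMap K (Algebra.adjoin K G) c) hv
      | add a b _ _ ha hb =>
        intro v hv
        rw [add_mul]
        exact add_mem (ha v hv) (hb v hv)
      | mul a b _ _ ha hb =>
        intro v hv
        rw [mul_assoc]
        exact ha _ (hb v hv)
    have hsV := hmul 1 (Submodule.subset_span ⟨0, pow_zero x⟩)
    rw [mul_one] at hsV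
    obtain ⟨p, hp⟩ := Finsupp.mem_span_range_iff_exists_finsupp.mp hsV
    refine ⟨p, hp.symm, fun p' hp' => hli ?_⟩
    exact hp'.symm.trans hp.symm

theorem ne_zero_of_linearIndependent_pow {S : Subalgebra K F} {x : F}
    (h : LinearIndependent S (fun n : ℕ => x ^ n)) : x ≠ 0 := by
  have := h.ne_zero 1
  simpa using this

/-- Elements of a division ring that commute up to the scalars `Λ`, each with powers left
independent over the subalgebra generated by its predecessors, generate a quantum affine space;
its automorphisms are conjugations. -/
theorem isQuantumAffineSpace_of_linearIndependent {N : ℕ} (Λ : Matrix (Fin N) (Fin N) Kˣ)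
    (x : Fin N → F)
    (hcomm : ∀ i l : Fin N, l < i → x i * x l = (Λ i l : K) • (x l * x i))
    (hli : ∀ i : Fin N, LinearIndependent (initialSubalgebra K x i) (fun n : ℕ => x i ^ n)) :
    IsQuantumAffineSpace Λ (Algebra.adjoin K (Set.range x)) x := by
  have hx : ∀ i, x i ≠ 0 := fun i => ne_zero_of_linearIndependent_pow (hli i)
  have hS : ∀ i : Fin N, (initialSubalgebra K x i).map (conjugation K (x i) (hx i) : F →ₐ[K] F) =
      initialSubalgebra K x i := by
    intro i
    refine map_conjugation_adjoin (hx i) ?_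
    rintro _ ⟨l, hl, rfl⟩
    exact ⟨Λ i l, hcomm i l hl⟩
  refine ⟨fun i => conjugationOn (hx i) (hS i), ⟨(algebraMap K F).injective, fun i => ?_,
    initialSubalgebra_eq_adjoin_range x⟩, fun i l h => Subtype.ext ?_⟩
  · rw [initialSubalgebra_succ]
    exact isOreExtension_adjoin_insert (hx i) (hS i) (hli i)
  · rw [coe_conjugationOn]
    change x i * x l * (x i)⁻¹ = (Λ i l : K) • x l
    rw [hcomm i l h, smul_mul_assoc, mul_assoc, mul_inv_cancel₀ (hx i), mul_one]

theorem mul_pow_eq_smul {a x : F} {c : K} (h : a * x = c • (x * a)) (m : ℕ) :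
    a * x ^ m = c ^ m • (x ^ m * a) := by
  induction m with
  | zero => simp
  | succ m ih =>
    rw [pow_succ, ← mul_assoc, ih, smul_mul_assoc, mul_assoc, h, mul_smul_comm, smul_smul,
      ← pow_succ, mul_assoc]

theorem pow_mul_pow_eq_smul {a x : F} {c : K} (h : a * x = c • (x * a)) (n m : ℕ) :
    a ^ n * x ^ m = c ^ (m * n) • (x ^ m * a ^ n) := by
  induction n with
  | zero => simp
  | succ n ih =>
    rw [pow_succ, mul_assoc, mul_pow_eq_smul h, mul_smul_comm, ← mul_assoc, ih, smul_mul_assoc,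
      smul_smul, ← pow_add, Nat.mul_succ, mul_assoc, add_comm m]

/-- If `x ∈ S` commutes up to scalars with the generators in `G`, and each of them can be moved
into `S` by a power of `x`, then the same holds for all elements of `K⟨G⟩`. It suffices to look
at the products of generators: they commute with `x` up to scalars. -/
theorem exists_forall_mul_pow_mem {G : Set F} {S : Subalgebra K F} {x : F} (hxS : x ∈ S)
    (hG : ∀ g ∈ G, (∃ c : K, g * x = c • (x * g)) ∧ ∃ m : ℕ, g * x ^ m ∈ S) {s : F}
    (hs : s ∈ Algebra.adjoin K G) : ∃ m, ∀ n, m ≤ n → s * x ^ n ∈ S := by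
  have hmono : ∀ {s : F} {m : ℕ}, s * x ^ m ∈ S → ∀ n, m ≤ n → s * x ^ n ∈ S := by
    intro s m h n hn
    obtain ⟨k, rfl⟩ := Nat.exists_eq_add_of_le hn
    rw [pow_add, ← mul_assoc]
    exact mul_mem h (pow_mem hxS k)
  rw [← Subalgebra.mem_toSubmodule, Algebra.adjoin_eq_span] at hs
  induction hs using Submodule.span_induction with
  | mem s hs =>
    have h : (∃ c : K, s * x = c • (x * s)) ∧ ∃ m : ℕ, s * x ^ m ∈ S := by
      induction hs using Submonoid.closure_induction with
      | mem g hg => exact hG g hg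
      | one => exact ⟨⟨1, by simp⟩, ⟨0, by simp⟩⟩
      | mul s t _ _ hs ht =>
        obtain ⟨⟨c, hc⟩, m, hm⟩ := hs
        obtain ⟨⟨e, he⟩, n, hn⟩ := ht
        refine ⟨⟨c * e, ?_⟩, m + n, ?_⟩
        · rw [mul_assoc, he, mul_smul_comm, ← mul_assoc, hc, smul_mul_assoc, smul_smul, mul_assoc,
            mul_comm e]
        · have h1 : s * t * x ^ (m + n) = e ^ m • (s * x ^ m * (t * x ^ n)) := by
            rw [pow_add, mul_assoc s, ← mul_assoc t, mul_pow_eq_smul he, smul_mul_assoc,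
              mul_smul_comm]
            simp only [mul_assoc]
          rw [h1]
          exact Subalgebra.smul_mem _ (mul_mem hm hn) _
    obtain ⟨-, m, hm⟩ := h
    exact ⟨m, hmono hm⟩
  | zero => exact ⟨0, fun n _ => by rw [zero_mul]; exact zero_mem S⟩
  | add s t _ _ hs ht =>
    obtain ⟨m, hm⟩ := hs
    obtain ⟨n, hn⟩ := ht
    refine ⟨max m n, fun k hk => ?_⟩
    rw [add_mul]
    exact add_mem (hm k ((le_max_left _ _).trans hk)) (hn k ((le_max_right _ _).trans hk))
  | smul c s _ hs =>
    obtain ⟨m, hm⟩ := hs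
    exact ⟨m, fun n hn => by rw [smul_mul_assoc]; exact Subalgebra.smul_mem _ (hm n hn) _⟩

/-- Left independence of the powers of `z` passes from `S` to `K⟨G⟩` when a power of `x` moves
each element of `K⟨G⟩` into `S` and `z` commutes with `x` up to a nonzero scalar. -/
theorem linearIndependent_pow_adjoin {G : Set F} {S : Subalgebra K F} {x z : F} (hxS : x ∈ S)
    (hx : x ≠ 0) (hG : ∀ g ∈ G, (∃ c : K, g * x = c • (x * g)) ∧ ∃ m : ℕ, g * x ^ m ∈ S)
    {c : Kˣ} (hz : z * x = (c : K) • (x * z))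
    (hli : LinearIndependent S (fun n : ℕ => z ^ n)) :
    LinearIndependent (Algebra.adjoin K G) (fun n : ℕ => z ^ n) := by
  rw [linearIndependent_pow_iff] at hli ⊢
  intro n g hg k hk
  choose M hM using fun k => exists_forall_mul_pow_mem hxS hG (g k).2
  let m := (Finset.range n).sup M
  have hm : ∀ i < n, (g i : F) * x ^ m ∈ S := fun i hi =>
    hM i m (Finset.le_sup (f := M) (Finset.mem_range.mpr hi))
  let a : ℕ → S := fun i =>
    if hi : i < n then (c : K) ^ (m * i) • ⟨(g i : F) * x ^ m, hm i hi⟩ else 0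
  have ha := hli n a (by
    have h1 := congrArg (· * x ^ m) hg
    simp only [Finset.sum_mul, zero_mul] at h1
    rw [← h1]
    refine Finset.sum_congr rfl fun i hi => ?_
    simp only [a, dif_pos (Finset.mem_range.mp hi)]
    rw [mul_assoc (g i : F), pow_mul_pow_eq_smul hz, SetLike.val_smul, smul_mul_assoc,
      mul_smul_comm, mul_assoc]) k hk
  simp only [a, dif_pos hk] at ha
  have h2 := (smul_eq_zero.mp ha).resolve_left (pow_ne_zero _ c.ne_zero)
  exact Subtype.ext ((mul_eq_zero.mp (congrArg Subtype.val h2)).resolve_right (pow_ne_zero _ hx))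

end Quantum

/-! ### The deletion step -/

section Step

variable {K : Type*} [Field K] {A : Type*} [Ring A] [Algebra K A] {N : ℕ}
  {F : Type*} [DivisionRing F] [Algebra K F]

/-- The family `x` in `F` presents an iterated Ore extension in which only the first `m`
indeterminates carry skew-derivations: `K⟨x_l : l < m⟩` is a copy of `K⟨X_l : l < m⟩`, and each
later `x_i` commutes up to the scalars `λ_{i,l}` with its predecessors and has powers that are left
independent over the subalgebra they generate. -/
structure IsPartialDeletion (D : QuantumNilpotentAlgebra K A N) (m : ℕ) (x : Fin N → F) :
    Prop where
  exists_algHom : ∃ ψ : initialSubalgebra K D.X m →ₐ[K] F, Function.Injective ψ ∧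
    ∀ (l : Fin N) (h : (l : ℕ) < m), ψ ⟨D.X l, mem_initialSubalgebra D.X h⟩ = x l
  comm : ∀ i l : Fin N, m ≤ (i : ℕ) → l < i → x i * x l = (D.Λ i l : K) • (x l * x i)
  linearIndependent : ∀ i : Fin N, m ≤ (i : ℕ) →
    LinearIndependent (initialSubalgebra K x i) (fun n : ℕ => x i ^ n)

/-- The family `y` arises from `x` by the step of the algorithm that deletes `δ_j`. -/
structure IsDeletionStep (D : QuantumNilpotentAlgebra K A N) (j : Fin N) (x y : Fin N → F) :
    Prop where
  ge : ∀ l : Fin N, j ≤ l → y l = x l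
  lt : ∃ φ : initialSubalgebra K D.X j ≃ₐ[K] initialSubalgebra K x j,
      (∀ (l : Fin N) (h : l < j), φ (gen K D.X h) = gen K x h) ∧
      ∀ (l : Fin N) (h : l < j),
        y l = ∑ᶠ n : ℕ, ((D.q j : K) ^ (n * (n + 1) / 2) * (((D.q j : K) - 1) ^ n)⁻¹) •
            ((φ (D.d j n (((D.σ j).symm ^ n) (gen K D.X h))) : F) * (x j)⁻¹ ^ n)

variable {D : QuantumNilpotentAlgebra K A N}

theorem IsOreExtension.map_mul_map {R S : Subalgebra K A} {x : A}
    {σ : R ≃ₐ[K] R} {δ : R →ₗ[K] R} (h : IsOreExtension R S x σ δ) (ψ : S →ₐ[K] F) (r : R) :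
    ψ ⟨x, h.mem⟩ * ψ.comp (Subalgebra.inclusion h.le) r =
      ψ.comp (Subalgebra.inclusion h.le) (σ r) * ψ ⟨x, h.mem⟩ +
        ψ.comp (Subalgebra.inclusion h.le) (δ r) := by
  have h1 : (⟨x, h.mem⟩ : S) * Subalgebra.inclusion h.le r =
      Subalgebra.inclusion h.le (σ r) * ⟨x, h.mem⟩ + Subalgebra.inclusion h.le (δ r) :=
    Subtype.ext (h.commutation r)
  have h2 := congrArg ψ h1
  rwa [map_add, map_mul, map_mul] at h2

theorem IsOreExtension.linearIndependent_pow_range {R S : Subalgebra K A} {x : A}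
    {σ : R ≃ₐ[K] R} {δ : R →ₗ[K] R} (h : IsOreExtension R S x σ δ) {ψ : S →ₐ[K] F}
    (hψ : Function.Injective ψ) :
    LinearIndependent (ψ.comp (Subalgebra.inclusion h.le)).range
      (fun n : ℕ => ψ ⟨x, h.mem⟩ ^ n) := by
  have hli := linearIndependent_pow_iff.mp h.linearIndependent_pow
  rw [linearIndependent_pow_iff]
  intro n g hg k hk
  choose r hr using fun k => (AlgHom.mem_range _).mp (g k).2
  have h1 : ψ (∑ k ∈ Finset.range n, Subalgebra.inclusion h.le (r k) * ⟨x, h.mem⟩ ^ k) = 0 := by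
    rw [map_sum, ← hg]
    refine Finset.sum_congr rfl fun k _ => ?_
    rw [map_mul, map_pow, ← hr k, AlgHom.comp_apply]
  have h2 := congrArg Subtype.val ((map_eq_zero_iff ψ hψ).mp h1)
  have h3 := hli n r (by
    rw [← ZeroMemClass.coe_zero S, ← h2, AddSubmonoidClass.coe_finsetSum]
    rfl) k hk
  refine Subtype.ext ?_
  rw [← hr k, h3, map_zero, ZeroMemClass.coe_zero]

namespace IsPartialDeletion

/-- The presentation of `K⟨X_l : l ≤ j⟩` as an Ore extension, transported to `F`. -/
theorem exists_algHom_of_succ {j : Fin N} {x : Fin N → F}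
    (h : IsPartialDeletion D ((j : ℕ) + 1) x) :
    ∃ ψ : initialSubalgebra K D.X j →ₐ[K] F, Function.Injective ψ ∧
      (∀ (l : Fin N) (h : l < j), ψ (gen K D.X h) = x l) ∧
      (∀ r, x j * ψ r = ψ (D.σ j r) * x j + ψ (D.δ j r)) ∧
      LinearIndependent ψ.range (fun n : ℕ => x j ^ n) := by
  obtain ⟨ψ, hψ, hx⟩ := h.exists_algHom
  have hO := D.isIteratedOreExtension.step j
  have hj : ψ ⟨D.X j, hO.mem⟩ = x j := hx j (Nat.lt_succ_self _)
  have hgen : ∀ (l : Fin N) (h : l < j),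
      ψ.comp (Subalgebra.inclusion hO.le) (gen K D.X h) = x l := by
    intro l hl
    have hl' : (l : ℕ) < (j : ℕ) + 1 := Nat.lt_succ_of_lt hl
    have h1 : Subalgebra.inclusion hO.le (gen K D.X hl) =
        ⟨D.X l, mem_initialSubalgebra D.X hl'⟩ := rfl
    rw [AlgHom.comp_apply, h1, hx l hl']
  have hinj : Function.Injective (ψ.comp (Subalgebra.inclusion hO.le)) := by
    rw [AlgHom.coe_comp]
    exact hψ.comp (Subalgebra.inclusion_injective hO.le)
  have hcomm : ∀ r, x j * ψ.comp (Subalgebra.inclusion hO.le) r =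
      ψ.comp (Subalgebra.inclusion hO.le) (D.σ j r) * x j +
        ψ.comp (Subalgebra.inclusion hO.le) (D.δ j r) := by
    rw [← hj]
    exact hO.map_mul_map ψ
  have hli : LinearIndependent (ψ.comp (Subalgebra.inclusion hO.le)).range
      (fun n : ℕ => x j ^ n) := by
    rw [← hj]
    exact hO.linearIndependent_pow_range hψ
  exact ⟨_, hinj, hgen, hcomm, hli⟩

theorem ne_zero {j : Fin N} {x : Fin N → F} (h : IsPartialDeletion D ((j : ℕ) + 1) x) :
    x j ≠ 0 := by
  obtain ⟨ψ, -, -, -, hli⟩ := h.exists_algHom_of_succ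
  exact ne_zero_of_linearIndependent_pow hli

theorem isDeletionDatum {j : Fin N} (hj : 0 < (j : ℕ)) {x : Fin N → F}
    (h : IsPartialDeletion D ((j : ℕ) + 1) x) {ψ : initialSubalgebra K D.X j →ₐ[K] F}
    (hψ : ∀ r, x j * ψ r = ψ (D.σ j r) * x j + ψ (D.δ j r)) :
    IsDeletionDatum ψ (x j) (D.q j : K) (D.σ j) (D.δ j) (D.d j) where
  x_ne_zero := h.ne_zero
  q_ne_zero := (D.q j).ne_zero
  q_ne_one := fun h1 => D.q_ne_one j hj (Units.ext h1)
  commutation := hψ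
  higher := D.higher j hj
  locallyNilpotent := D.locallyNilpotent j hj
  iterative := D.iterative j hj

/-- Conjugation by a later `x_i` acts on `K⟨x_l : l < j⟩` as `σ_i`. -/
theorem exists_mul_eq_mul {i j : Fin N} (hji : j < i) {x : Fin N → F}
    (h : IsPartialDeletion D ((j : ℕ) + 1) x) {ψ : initialSubalgebra K D.X j →ₐ[K] F}
    (hψ : ∀ (l : Fin N) (h : l < j), ψ (gen K D.X h) = x l) (r : initialSubalgebra K D.X j) :
    ∃ r' : initialSubalgebra K D.X j,
      (D.σ i (Subalgebra.inclusion (initialSubalgebra_mono D.X hji.le) r) : A) = r' ∧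
      x i * ψ r = ψ r' * x i := by
  have hmono := initialSubalgebra_mono (K := K) D.X hji.le
  induction r using initialSubalgebra_induction with
  | mem l hl =>
    have hlj : l < j := hl
    refine ⟨(D.Λ i l : K) • gen K D.X hlj, ?_, ?_⟩
    · rw [Subalgebra.inclusion_mk, Subalgebra.coe_smul]
      exact congrArg Subtype.val (D.σ_gen i l (hlj.trans hji))
    · have h1 : ψ ⟨D.X l, mem_initialSubalgebra D.X hl⟩ = x l := hψ l hlj
      rw [map_smul, hψ l hlj, smul_mul_assoc, ← h.comm i l hji (hlj.trans hji), h1]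
  | algebraMap c =>
    refine ⟨algebraMap K _ c, ?_, ?_⟩
    · rw [AlgHom.commutes, AlgEquiv.commutes, Subalgebra.coe_algebraMap,
        Subalgebra.coe_algebraMap]
    · rw [AlgHom.commutes, Algebra.commutes]
  | add r s hr hs =>
    obtain ⟨r', h1, h2⟩ := hr
    obtain ⟨s', h3, h4⟩ := hs
    refine ⟨r' + s', ?_, ?_⟩
    · rw [map_add, map_add, Subalgebra.coe_add, Subalgebra.coe_add, h1, h3]
    · rw [map_add, map_add, mul_add, add_mul, h2, h4]
  | mul r s hr hs =>
    obtain ⟨r', h1, h2⟩ := hr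
    obtain ⟨s', h3, h4⟩ := hs
    refine ⟨r' * s', ?_, ?_⟩
    · rw [map_mul, map_mul, Subalgebra.coe_mul, Subalgebra.coe_mul, h1, h3]
    · rw [map_mul, map_mul, ← mul_assoc, h2, mul_assoc, h4, mul_assoc]

theorem symm_pow_gen {j l : Fin N} (h : l < j) (n : ℕ) :
    ∃ c : K, ((D.σ j).symm ^ n) (gen K D.X h) = c • gen K D.X h := by
  induction n with
  | zero => exact ⟨1, by rw [pow_zero, one_smul, AlgEquiv.one_apply]⟩
  | succ n ih =>
    obtain ⟨c, hc⟩ := ih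
    refine ⟨c * ((D.Λ j l)⁻¹ : Kˣ), ?_⟩
    have h1 : (D.σ j).symm (gen K D.X h) = (((D.Λ j l)⁻¹ : Kˣ) : K) • gen K D.X h := by
      rw [AlgEquiv.symm_apply_eq, map_smul, D.σ_gen, smul_smul, Units.inv_mul, one_smul]
    rw [pow_succ', AlgEquiv.mul_apply, hc, map_smul, h1, smul_smul]

/-- A later `x_i` commutes with the new generators up to the same scalars as with the old ones:
the factors `λ_{i,j}^n` from `σ_i ∘ d_{j,n}` and `λ_{i,j}^{-n}` from `x_j⁻ⁿ` cancel. -/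
theorem mul_deletion_gen {i j l : Fin N} (hj : 0 < (j : ℕ)) (hji : j < i) (hlj : l < j)
    {x : Fin N → F} (h : IsPartialDeletion D ((j : ℕ) + 1) x)
    {ψ : initialSubalgebra K D.X j →ₐ[K] F}
    (hψ : ∀ (l : Fin N) (h : l < j), ψ (gen K D.X h) = x l)
    (hψc : ∀ r, x j * ψ r = ψ (D.σ j r) * x j + ψ (D.δ j r)) :
    x i * deletion ψ (x j) (D.q j : K) (D.σ j) (D.d j) (gen K D.X hlj) =
      (D.Λ i l : K) •
        (deletion ψ (x j) (D.q j : K) (D.σ j) (D.d j) (gen K D.X hlj) * x i) := by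
  obtain ⟨M, hM⟩ := (h.isDeletionDatum hj hψc).exists_deletion_eq_sum (gen K D.X hlj)
  rw [hM M le_rfl, Finset.mul_sum, Finset.sum_mul, Finset.smul_sum]
  refine Finset.sum_congr rfl fun n _ => ?_
  set r := ((D.σ j).symm ^ n) (gen K D.X hlj) with hr
  have hσr : (D.σ i (Subalgebra.inclusion (initialSubalgebra_mono D.X hji.le) r) : A) =
      ((D.Λ i l : K) • r : initialSubalgebra K D.X j) := by
    obtain ⟨c, hc⟩ := symm_pow_gen (D := D) hlj n
    rw [hr, hc, map_smul, map_smul, smul_comm]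
    exact congrArg (fun a => c • (Subtype.val a)) (D.σ_gen i l (hlj.trans hji))
  obtain ⟨r', h1, h2⟩ := h.exists_mul_eq_mul hji hψ (D.d j n r)
  have h3 := D.σ_d j i hj hji n r ((D.Λ i l : K) • r)
    (Subalgebra.inclusion (initialSubalgebra_mono D.X hji.le) r)
    (Subalgebra.inclusion (initialSubalgebra_mono D.X hji.le) (D.d j n r)) rfl rfl hσr
  have hr' : r' = (D.Λ i j : K) ^ n • (D.Λ i l : K) • D.d j n r := by
    rw [← map_smul]
    exact Subtype.ext (h1.symm.trans h3)
  have hinv : x i * (x j)⁻¹ = (D.Λ i j : K)⁻¹ • ((x j)⁻¹ * x i) := by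
    rw [eq_inv_smul_iff₀ (D.Λ i j).ne_zero, ← mul_right_inj' h.ne_zero, mul_smul_comm,
      ← mul_assoc (x j), ← smul_mul_assoc, ← h.comm i j hji hji,
      mul_inv_cancel_right₀ h.ne_zero, mul_inv_cancel_left₀ h.ne_zero]
  rw [mul_smul_comm, ← mul_assoc, h2, hr', map_smul, map_smul, mul_assoc _ (x i),
    mul_pow_eq_smul hinv]
  simp only [smul_mul_assoc, mul_smul_comm, smul_smul, mul_assoc]
  congr 1
  rw [inv_pow]
  have := pow_ne_zero n (D.Λ i j).ne_zero
  field_simp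

/-- One step of the algorithm: deleting `δ_j` leaves skew-derivations only on the first `j`
indeterminates. -/
theorem of_deletion {j : Fin N} (hj : 0 < (j : ℕ)) {x y : Fin N → F}
    (h : IsPartialDeletion D ((j : ℕ) + 1) x)
    {ψ : initialSubalgebra K D.X j →ₐ[K] F} (hinj : Function.Injective ψ)
    (hψ : ∀ (l : Fin N) (h : l < j), ψ (gen K D.X h) = x l)
    (hψc : ∀ r, x j * ψ r = ψ (D.σ j r) * x j + ψ (D.δ j r))
    (hli : LinearIndependent ψ.range (fun n : ℕ => x j ^ n))
    (hge : ∀ l : Fin N, j ≤ l → y l = x l)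
    (hlt : ∀ (l : Fin N) (h : l < j),
      y l = deletion ψ (x j) (D.q j : K) (D.σ j) (D.d j) (gen K D.X h)) :
    IsPartialDeletion D j y := by
  have hd := h.isDeletionDatum hj hψc
  have hxj := h.ne_zero
  -- `x_j` acts on each new generator `y_l`, `l < j`, by the scalar `λ_{j,l}`.
  have hcj : ∀ l : Fin N, l < j → x j * y l = (D.Λ j l : K) • (y l * x j) := by
    intro l hl
    rw [hlt l hl, hd.mul_deletion, D.σ_gen, hd.deletion_smul, smul_mul_assoc]
  have hcomm : ∀ i l : Fin N, (j : ℕ) ≤ i → l < i → y i * y l = (D.Λ i l : K) • (y l * y i) := by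
    intro i l hji hl
    rw [hge i hji]
    rcases lt_or_ge l j with hlj | hlj
    · rcases eq_or_lt_of_le (show j ≤ i from hji) with rfl | hji'
      · exact hcj l hl
      · rw [hlt l hlj]
        exact h.mul_deletion_gen hj hji' hlj hψ hψc
    · rw [hge l hlj]
      exact h.comm i l (lt_of_le_of_lt hlj hl) hl
  refine ⟨⟨hd.deletionHom hinj hli, hd.deletion_injective hinj hli, fun l hl => (hlt l hl).symm⟩,
    hcomm, fun i hji => ?_⟩
  rcases eq_or_lt_of_le (show j ≤ i from hji) with rfl | hji'
  · have h1 := hd.linearIndependent_pow_range_deletionHom hinj hli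
    rwa [range_eq_initialSubalgebra (y := y) fun l hl => (hlt l hl).symm, ← hge j le_rfl] at h1
  · rw [hge i hji]
    refine linearIndependent_pow_adjoin (mem_initialSubalgebra x hji') hxj ?_
      (h.comm i j hji' hji') (h.linearIndependent i hji')
    rintro _ ⟨l, hl, rfl⟩
    rcases lt_or_ge l j with hlj | hlj
    · refine ⟨⟨((D.Λ j l)⁻¹ : Kˣ), ?_⟩, ?_⟩
      · rw [hcj l hlj, smul_smul, Units.inv_mul, one_smul]
      · rw [hlt l hlj]
        refine hd.exists_deletion_mul_pow_mem ?_ (mem_initialSubalgebra x hji') _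
        rw [range_eq_initialSubalgebra (y := x) hψ]
        exact initialSubalgebra_mono x hji
    · rw [hge l hlj]
      refine ⟨?_, 0, ?_⟩
      · rcases eq_or_lt_of_le hlj with rfl | hlj'
        · exact ⟨1, by rw [one_smul]⟩
        · exact ⟨_, h.comm l j hlj' hlj'⟩
      · rw [pow_zero, mul_one]
        exact mem_initialSubalgebra x hl

theorem step {j : Fin N} (hj : 0 < (j : ℕ)) {x y : Fin N → F}
    (h : IsPartialDeletion D ((j : ℕ) + 1) x) (hxy : IsDeletionStep D j x y) :
    IsPartialDeletion D j y := by
  obtain ⟨ψ, hinj, hψ, hψc, hli⟩ := h.exists_algHom_of_succ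
  obtain ⟨φ, hφ, hy⟩ := hxy.lt
  have hφψ : (initialSubalgebra K x j).val.comp (φ : _ →ₐ[K] _) = ψ :=
    algHom_ext_initialSubalgebra fun l hl =>
      (congrArg Subtype.val (hφ l hl)).trans (hψ l hl).symm
  refine h.of_deletion hj hinj hψ hψc hli hxy.ge fun l hl => ?_
  rw [hy l hl, ← hφψ]
  rfl

theorem exists_step {j : Fin N} {x : Fin N → F} (h : IsPartialDeletion D ((j : ℕ) + 1) x) :
    ∃ y, IsDeletionStep D j x y := by
  obtain ⟨ψ, hinj, hψ, -, -⟩ := h.exists_algHom_of_succ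
  let φ : initialSubalgebra K D.X j ≃ₐ[K] initialSubalgebra K x j :=
    (AlgEquiv.ofInjective ψ hinj).trans
      (Subalgebra.equivOfEq _ _ (range_eq_initialSubalgebra (y := x) hψ))
  refine ⟨fun l => if hl : l < j then
      deletion ψ (x j) (D.q j : K) (D.σ j) (D.d j) (gen K D.X hl) else x l,
    fun l hl => dif_neg (not_lt.mpr hl), φ, fun l hl => Subtype.ext (hψ l hl), fun l hl => ?_⟩
  exact dif_pos hl

/-- All indeterminates but the first have lost their skew-derivations, and the first has none. -/
theorem isQuantumAffineSpace {x : Fin N → F} (h : IsPartialDeletion D 1 x) :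
    IsQuantumAffineSpace D.Λ (Algebra.adjoin K (Set.range x)) x := by
  refine isQuantumAffineSpace_of_linearIndependent D.Λ x
    (fun i l hl => h.comm i l (Nat.one_le_iff_ne_zero.mpr fun h0 => ?_) hl) fun i => ?_
  · have := Fin.lt_def.mp hl
    omega
  · rcases Nat.eq_zero_or_pos (i : ℕ) with hi | hi
    · have h' : IsPartialDeletion D ((i : ℕ) + 1) x := by rwa [hi]
      obtain ⟨ψ, -, hψ, -, hli⟩ := h'.exists_algHom_of_succ
      rwa [range_eq_initialSubalgebra (y := x) hψ] at hli
    · exact h.linearIndependent i hi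

theorem of_injective {ι : A →ₐ[K] F} (hι : Function.Injective ι) :
    IsPartialDeletion D N fun l => ι (D.X l) :=
  ⟨⟨ι.comp (Subalgebra.val _), hι.comp Subtype.val_injective, fun _ _ => rfl⟩,
    fun i _ hi => absurd i.2 (not_lt.mpr hi), fun i hi => absurd i.2 (not_lt.mpr hi)⟩

end IsPartialDeletion

namespace IsDeletingDerivations

variable {ι : A →ₐ[K] F} {Y : ℕ → Fin N → F}

theorem isDeletionStep (h : IsDeletingDerivations D ι Y) {j : Fin N} (hj : 0 < (j : ℕ)) :
    IsDeletionStep D j (Y ((j : ℕ) + 2)) (Y ((j : ℕ) + 1)) :=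
  ⟨h.step_ge j hj, h.step_lt j hj⟩

theorem isPartialDeletion (h : IsDeletingDerivations D ι Y) (hι : Function.Injective ι) {m : ℕ}
    (hm : 1 ≤ m) (hmN : m ≤ N) : IsPartialDeletion D m (Y (m + 1)) := by
  induction hmN using Nat.decreasingInduction with
  | self => exact (funext h.start : Y (N + 1) = _) ▸ IsPartialDeletion.of_injective hι
  | of_succ m hmN ih =>
    exact (ih (Nat.le_add_left 1 m)).step (j := ⟨m, hmN⟩) hm (h.isDeletionStep hm)

end IsDeletingDerivations

theorem exists_isDeletingDerivations (D : QuantumNilpotentAlgebra K A N) {ι : A →ₐ[K] F}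
    (hι : Function.Injective ι) : ∃ Y : ℕ → Fin N → F, IsDeletingDerivations D ι Y := by
  have hstep : ∀ (j : Fin N) (x : Fin N → F), ∃ y,
      IsPartialDeletion D ((j : ℕ) + 1) x → IsDeletionStep D j x y := by
    intro j x
    by_cases h : IsPartialDeletion D ((j : ℕ) + 1) x
    · obtain ⟨y, hy⟩ := h.exists_step
      exact ⟨y, fun _ => hy⟩
    · exact ⟨x, fun h' => absurd h' h⟩
  choose f hf using hstep
  -- `Z k` is the family after `k` steps, the next one being that for the index `N - 1 - k`.
  let Z : ℕ → Fin N → F := fun k => Nat.rec (fun l => ι (D.X l))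
    (fun k x => if h : N - 1 - k < N then f ⟨N - 1 - k, h⟩ x else x) k
  have hZ : ∀ (k : ℕ) (j : Fin N), N - 1 - k = j → Z (k + 1) = f j (Z k) := by
    rintro k ⟨j, hj⟩ rfl
    exact dif_pos hj
  have hP : ∀ k m : ℕ, 1 ≤ m → m + k = N → IsPartialDeletion D m (Z k) := by
    intro k
    induction k with
    | zero =>
      rintro m - rfl
      exact IsPartialDeletion.of_injective hι
    | succ k ih =>
      intro m hm hmk
      have h1 := ih (m + 1) (Nat.le_add_left 1 m) (by omega)
      rw [hZ k ⟨m, by omega⟩ (by dsimp only; omega)]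
      exact h1.step (j := ⟨m, by omega⟩) hm (hf _ _ h1)
  have hS : ∀ j : Fin N,
      IsDeletionStep D j (Z (N + 1 - ((j : ℕ) + 2))) (Z (N + 1 - ((j : ℕ) + 1))) := by
    intro j
    have h1 : N + 1 - ((j : ℕ) + 1) = N + 1 - ((j : ℕ) + 2) + 1 := by omega
    rw [h1, hZ _ j (by omega)]
    exact hf j _ (hP _ _ (Nat.le_add_left 1 _) (by omega))
  refine ⟨fun m => Z (N + 1 - m), fun l => ?_, fun j _ => (hS j).ge, fun j _ => (hS j).lt⟩
  rw [Nat.sub_self]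
  rfl

end Step

end DeletingDerivations

theorem corollary2p3 {K : Type*} [Field K] {A : Type*} [Ring A] [Algebra K A] {N : ℕ}
    (D : DeletingDerivations.QuantumNilpotentAlgebra K A N)
    {F : Type*} [DivisionRing F] [Algebra K F] (ι : A →ₐ[K] F)
    (hF : DeletingDerivations.IsDivisionRingOfFractions ι) :
    -- the algorithm can be carried out
    (∃ Y : ℕ → Fin N → F, DeletingDerivations.IsDeletingDerivations D ι Y) ∧
    -- its result is the quantum affine space in the elements of the last sequence
    ∀ Y : ℕ → Fin N → F, DeletingDerivations.IsDeletingDerivations D ι Y →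
      DeletingDerivations.IsQuantumAffineSpace D.Λ
        (Algebra.adjoin K (Set.range (Y 2))) (Y 2) := by
  refine ⟨DeletingDerivations.exists_isDeletingDerivations D hF.injective, fun Y hY => ?_⟩
  rcases Nat.eq_zero_or_pos N with rfl | hN
  · exact DeletingDerivations.isQuantumAffineSpace_of_linearIndependent _ _
      (fun i => i.elim0) fun i => i.elim0
  · exact (hY.isPartialDeletion hF.injective le_rfl hN).isQuantumAffineSpace
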